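/- Let $n\ge 3$, and let $T_n$ be any non-degenerate $n$-dimensional (closed, solid) simplex in Euclidean space $\mathbb{E}^n$. A lattice covering by $T_n$ is a family $T_n+\Lambda=\{T_n+u : u\in\Lambda\}$, where $\Lambda\subset\mathbb{E}^n$ is a full-rank lattice, whose union is $\mathbb{E}^n$. Its density is $$\theta(T_n,\Lambda)=\liminf_{\ell\to\infty}\frac{\sum_{u\in\Lambda}\mathrm{vol}\big((T_n+u)\cap \ell W_n\big)}{\mathrm{vol}(\ell W_n)},\qquad W_n=\{x\in\mathbb{E}^n : |x_i|\le \tfrac12 \text{ for all } i\}.$$ Let $\theta^l(T_n)$, the lattice covering density of $T_n$, be the infimum of $\theta(T_n,\Lambda)$ over all lattice coverings $T_n+\Lambda$. Then $$\theta^l(T_n)\ \ge\ 1+\frac{1}{2^{3n+7}}.$$ -/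

import Mathlib

open scoped ENNReal Pointwise

namespace LatticeCovering

/-- Euclidean `n`-space `𝔼ⁿ`, with its Euclidean norm and Lebesgue measure. -/
abbrev Space (n : ℕ) : Type := EuclideanSpace ℝ (Fin n)

/-- The `n`-dimensional unit cube centred at the origin. -/
def unitCube (n : ℕ) : Set (Space n) := {x | ∀ i, |x i| ≤ 1 / 2}

/-- A family of sets is a covering of `𝔼ⁿ` if its union is the whole space. -/
def IsCovering {n : ℕ} {ι : Type*} (𝒦 : ι → Set (Space n)) : Prop :=
  ⋃ i, 𝒦 i = Set.univ

/-- The density of a family of sets: the lower limit, for `ℓ → ∞`, of the total volume (counted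
with multiplicity) of the members inside the cube `ℓ W`, divided by the volume of that cube.
It takes values in `[0, ∞]`. -/
noncomputable def density {n : ℕ} {ι : Type*} (𝒦 : ι → Set (Space n)) : ℝ≥0∞ :=
  Filter.liminf
    (fun ℓ : ℝ => (∑' i, MeasureTheory.volume (𝒦 i ∩ ℓ • unitCube n)) /
      MeasureTheory.volume (ℓ • unitCube n))
    Filter.atTop

/-- A (full-rank) lattice in `𝔼ⁿ`: a discrete additive subgroup that spans the space over `ℝ`. -/
def IsLattice {n : ℕ} (Λ : Submodule ℤ (Space n)) : Prop :=
  ∃ _ : DiscreteTopology Λ, IsZLattice ℝ Λ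

/-- The family `K + Λ` of the translates of `K` by the points of `Λ`. -/
def translates {n : ℕ} (K : Set (Space n)) (Λ : Submodule ℤ (Space n)) : Λ → Set (Space n) :=
  fun u => (u : Space n) +ᵥ K

/-- The lattice covering density `θˡ(K)`: the infimum of the densities of the lattice coverings
`K + Λ` of `𝔼ⁿ`. -/
noncomputable def latticeCoveringDensity {n : ℕ} (K : Set (Space n)) : ℝ≥0∞ :=
  ⨅ (Λ : Submodule ℤ (Space n)) (_ : IsLattice Λ) (_ : IsCovering (translates K Λ)),
    density (translates K Λ)

end LatticeCovering

/-!
Let `F` be a fundamental domain of a lattice `Λ` and suppose that the translates of a simplex `T`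
by `Λ` cover the space. If `u ∈ Λ` is nonzero, then `T \ (u + T)` still covers
(`iUnion_vadd_diff_vadd_eq_univ`), so `vol (T ∩ (u + T)) ≤ vol T - vol F`
(`measure_inter_vadd_add_measure_le`): in a thin covering all overlaps are small.

Two translates of a simplex meet in a homothetic simplex, of ratio `1 - ‖u‖` where `‖·‖` is the
gauge of the difference body `D = T - T` (`inter_vadd_convexHull_eq`). Small overlaps therefore mean
that every nonzero lattice vector has gauge close to `1`. By Minkowski's theorem this is impossible
if `D` is large enough compared with `2ⁿ vol T`. The volume of `D` is estimated by
integrating `vol (T ∩ (u + T)) = (1 - ‖u‖)ⁿ vol T` over `u`: by Tonelli the integral is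
`(vol T)²`, and by the layer-cake formula it is `vol T · vol D` times a Beta integral of size at most
`2n / 4ⁿ` (`measure_convexHull_le_measure_diffGauge`). For `n ≥ 3` this gives
`vol T ≥ (1 + 2^(-3n-7)) vol F` (`mul_measure_le_measure_convexHull`).

The density of the arrangement, a lower limit, is at least `vol T / vol F`, by counting the
translates of `F` inside slightly smaller cubes (`div_le_density_translates`).
-/

open MeasureTheory Module

/-! ### The gauge of the difference body of a simplex -/

section Coordinates

variable {ι E : Type*} [NormedAddCommGroup E] [NormedSpace ℝ E] (b : AffineBasis ι ℝ E)

lemma coord_add (i : ι) (x v : E) :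
    b.coord i (v + x) = (b.coord i).linear v + b.coord i x :=
  (b.coord i).map_vadd x v

/-- A point of `T ∩ (u + T)` is one whose barycentric coordinates dominate the positive parts of
those of the translation vector. -/
lemma mem_inter_vadd_convexHull_iff (u x : E) :
    x ∈ convexHull ℝ (Set.range b) ∩ (u +ᵥ convexHull ℝ (Set.range b)) ↔
      ∀ i, max 0 ((b.coord i).linear u) ≤ b.coord i x := by
  rw [Set.mem_inter_iff, Set.mem_vadd_set_iff_neg_vadd_mem, b.convexHull_eq_nonneg_coord,
    Set.mem_ofPred_eq, Set.mem_ofPred_eq, ← forall_and]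
  refine forall_congr' fun i => ?_
  rw [vadd_eq_add, coord_add, map_neg, max_le_iff, neg_add_eq_sub, sub_nonneg]

end Coordinates

section Gauge

variable {ι E : Type*} [Fintype ι] [NormedAddCommGroup E] [NormedSpace ℝ E]

/-- The gauge of the difference body `T - T` of the simplex `T` spanned by the affine basis `b`,
written in barycentric coordinates: `T - T` consists of the `u` with `diffGauge b u ≤ 1`. -/
noncomputable def diffGauge (b : AffineBasis ι ℝ E) (u : E) : ℝ := ∑ i, max 0 ((b.coord i).linear u)

variable (b : AffineBasis ι ℝ E)

lemma sum_coord_linear_eq_zero (u : E) : ∑ i, (b.coord i).linear u = 0 := by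
  have h := b.sum_coord_apply_eq_one (u + 0)
  simp only [coord_add, Finset.sum_add_distrib, b.sum_coord_apply_eq_one] at h
  linarith

lemma diffGauge_nonneg (u : E) : 0 ≤ diffGauge b u :=
  Finset.sum_nonneg fun _ _ => le_max_left _ _

lemma diffGauge_neg (u : E) : diffGauge b (-u) = diffGauge b u := by
  have h : diffGauge b u - diffGauge b (-u) = ∑ i, (b.coord i).linear u := by
    rw [diffGauge, diffGauge, ← Finset.sum_sub_distrib]
    refine Finset.sum_congr rfl fun i _ => ?_
    rw [map_neg]
    rcases le_total 0 ((b.coord i).linear u) with h | h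
    · rw [max_eq_right h, max_eq_left (by linarith)]; ring
    · rw [max_eq_left h, max_eq_right (by linarith)]; ring
  rw [sum_coord_linear_eq_zero] at h
  linarith

lemma diffGauge_add_le (u v : E) : diffGauge b (u + v) ≤ diffGauge b u + diffGauge b v := by
  rw [diffGauge, diffGauge, diffGauge, ← Finset.sum_add_distrib]
  refine Finset.sum_le_sum fun i _ => ?_
  rw [map_add]
  exact max_le (add_nonneg (le_max_left _ _) (le_max_left _ _))
    (add_le_add (le_max_right _ _) (le_max_right _ _))

lemma diffGauge_smul {t : ℝ} (ht : 0 ≤ t) (u : E) :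
    diffGauge b (t • u) = t * diffGauge b u := by
  rw [diffGauge, diffGauge, Finset.mul_sum]
  refine Finset.sum_congr rfl fun i _ => ?_
  rw [map_smul, smul_eq_mul, mul_max_of_nonneg _ _ ht, mul_zero]

lemma convex_diffGauge_lt (r : ℝ) : Convex ℝ {u | diffGauge b u < r} := by
  have h : ConvexOn ℝ Set.univ (diffGauge b) := ⟨convex_univ, fun x _ y _ s t hs ht _ => by
    simpa only [diffGauge_smul b hs, diffGauge_smul b ht, smul_eq_mul] using
      diffGauge_add_le b (s • x) (t • y)⟩
  simpa using h.convex_lt r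

lemma isCompact_convexHull_range : IsCompact (convexHull ℝ (Set.range b)) :=
  (Set.finite_range b).isCompact_convexHull (𝕜 := ℝ)

lemma continuous_diffGauge [FiniteDimensional ℝ E] : Continuous (diffGauge b) :=
  continuous_finsetSum _ fun _ _ => continuous_const.max
    (LinearMap.continuous_of_finiteDimensional _)

lemma setOf_diffGauge_lt_eq_smul {r : ℝ} (hr : 0 < r) :
    {u | diffGauge b u < r} = r • {u | diffGauge b u < 1} := by
  ext u
  rw [Set.mem_smul_set_iff_inv_smul_mem₀ hr.ne', Set.mem_ofPred_eq, Set.mem_ofPred_eq,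
    diffGauge_smul b (inv_nonneg.2 hr.le), inv_mul_lt_iff₀ hr, mul_one]

/-- Two overlapping translates of a simplex meet in a homothetic simplex. -/
lemma inter_vadd_convexHull_eq {u : E} (hu : diffGauge b u < 1) :
    convexHull ℝ (Set.range b) ∩ (u +ᵥ convexHull ℝ (Set.range b)) =
      (∑ j, max 0 ((b.coord j).linear u) • b j) +ᵥ
        ((1 - diffGauge b u) • convexHull ℝ (Set.range b)) := by
  have hpos : 0 < 1 - diffGauge b u := by linarith
  have hlin (i : ι) : (b.coord i).linear (∑ j, max 0 ((b.coord j).linear u) • b j) =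
      max 0 ((b.coord i).linear u) - diffGauge b u * b.coord i 0 := by
    classical
    have h (j : ι) : (b.coord i).linear (b j) = (if i = j then 1 else 0) - b.coord i 0 := by
      have := coord_add b i 0 (b j)
      rw [add_zero, b.coord_apply] at this
      linarith
    simp only [map_sum, map_smul, h, smul_eq_mul, mul_sub, Finset.sum_sub_distrib]
    simp [diffGauge, Finset.sum_mul]
  ext x
  rw [mem_inter_vadd_convexHull_iff, Set.mem_vadd_set_iff_neg_vadd_mem,
    Set.mem_smul_set_iff_inv_smul_mem₀ hpos.ne', b.convexHull_eq_nonneg_coord, Set.mem_ofPred_eq]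
  refine forall_congr' fun i => ?_
  have key : b.coord i ((1 - diffGauge b u)⁻¹ •
      (-(∑ j, max 0 ((b.coord j).linear u) • b j) +ᵥ x)) =
      (1 - diffGauge b u)⁻¹ * (b.coord i x - max 0 ((b.coord i).linear u)) := by
    have hx := coord_add b i 0 x
    rw [add_zero] at hx
    rw [← add_zero (_ • _), coord_add, map_smul, vadd_eq_add, map_add, map_neg, hlin, hx,
      smul_eq_mul]
    field_simp
    ring
  rw [key, mul_nonneg_iff_of_pos_left (inv_pos.2 hpos), sub_nonneg]

lemma inter_vadd_convexHull_subsingleton {u : E} (hu : 1 ≤ diffGauge b u) :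
    (convexHull ℝ (Set.range b) ∩ (u +ᵥ convexHull ℝ (Set.range b))).Subsingleton := by
  have key : ∀ x ∈ convexHull ℝ (Set.range b) ∩ (u +ᵥ convexHull ℝ (Set.range b)),
      ∀ i, b.coord i x = max 0 ((b.coord i).linear u) := by
    intro x hx i
    rw [mem_inter_vadd_convexHull_iff] at hx
    have hsum : ∑ j, max 0 ((b.coord j).linear u) = ∑ j, b.coord j x :=
      le_antisymm (Finset.sum_le_sum fun j _ => hx j)
        ((b.sum_coord_apply_eq_one x).trans_le hu)
    exact ((Finset.sum_eq_sum_iff_of_le fun j _ => hx j).1 hsum i (Finset.mem_univ i)).symm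
  exact fun x hx y hy => b.ext_elem fun i => (key x hx i).trans (key y hy i).symm

end Gauge

/-! ### The volume of the difference body -/

section Volume

variable {ι E : Type*} [Fintype ι] [NormedAddCommGroup E] [NormedSpace ℝ E]
  [FiniteDimensional ℝ E] [MeasurableSpace E] [BorelSpace E]
  (b : AffineBasis ι ℝ E) (μ : Measure E) [μ.IsAddHaarMeasure]

lemma measure_setOf_diffGauge_lt {r : ℝ} (hr : 0 < r) :
    μ {u | diffGauge b u < r} = ENNReal.ofReal (r ^ finrank ℝ E) * μ {u | diffGauge b u < 1} := by
  rw [setOf_diffGauge_lt_eq_smul b hr, Measure.addHaar_smul_of_nonneg μ hr.le]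

lemma measure_inter_vadd_convexHull {u : E} (hu : diffGauge b u < 1) :
    μ (convexHull ℝ (Set.range b) ∩ (u +ᵥ convexHull ℝ (Set.range b))) =
      ENNReal.ofReal ((1 - diffGauge b u) ^ finrank ℝ E) * μ (convexHull ℝ (Set.range b)) := by
  rw [inter_vadd_convexHull_eq b hu, measure_vadd,
    Measure.addHaar_smul_of_nonneg μ (by linarith)]

lemma measure_inter_vadd_convexHull_le [Nontrivial E] (u : E) :
    μ (convexHull ℝ (Set.range b) ∩ (u +ᵥ convexHull ℝ (Set.range b))) ≤
      ENNReal.ofReal (max 0 (1 - diffGauge b u) ^ finrank ℝ E) *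
        μ (convexHull ℝ (Set.range b)) := by
  rcases lt_or_ge (diffGauge b u) 1 with hu | hu
  · rw [measure_inter_vadd_convexHull b μ hu, max_eq_right (by linarith)]
  · rw [(inter_vadd_convexHull_subsingleton b hu).measure_zero]
    exact zero_le

/-- Integrating the overlaps of a set with its translates gives the square of its measure. -/
lemma lintegral_measure_inter_vadd {T : Set E} (hT : MeasurableSet T) :
    ∫⁻ u, μ (T ∩ (u +ᵥ T)) ∂μ = μ T * μ T := by
  have h (u : E) : μ (T ∩ (u +ᵥ T)) =
      ∫⁻ x, T.indicator 1 x * T.indicator 1 (x - u) ∂μ := by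
    rw [← lintegral_indicator_one (hT.inter (hT.const_vadd u))]
    refine lintegral_congr fun x => ?_
    rw [Set.inter_indicator_one, Pi.mul_apply]
    have hx : x ∈ u +ᵥ T ↔ x - u ∈ T := by
      rw [Set.mem_vadd_set_iff_neg_vadd_mem, vadd_eq_add, neg_add_eq_sub]
    by_cases h : x - u ∈ T <;> simp [Set.indicator, hx, h]
  have hm : Measurable (T.indicator (1 : E → ℝ≥0∞)) := measurable_one.indicator hT
  simp_rw [h]
  rw [lintegral_lintegral_swap (by fun_prop)]
  have h2 (x : E) : ∫⁻ u, T.indicator (1 : E → ℝ≥0∞) x * T.indicator 1 (x - u) ∂μ =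
      T.indicator 1 x * μ T := by
    rw [lintegral_const_mul _ (by fun_prop),
      lintegral_sub_left_eq_self (T.indicator (1 : E → ℝ≥0∞)) x, lintegral_indicator_one hT]
  simp_rw [h2]
  rw [lintegral_mul_const _ hm, lintegral_indicator_one hT]

/-- Since `t (1 - t) ≤ 1 / 4`, the Beta integral `∫ (1 - t)ⁿ tⁿ⁻¹` is at most `2 / 4ⁿ`. -/
lemma integral_one_sub_pow_mul_pow_le {n : ℕ} (hn : 0 < n) :
    ∫⁻ t in Set.Ioo (0 : ℝ) 1, ENNReal.ofReal ((1 - t) ^ n * t ^ (n - 1)) ≤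
      ENNReal.ofReal (2 / 4 ^ n) := by
  obtain ⟨m, rfl⟩ : ∃ m, n = m + 1 := ⟨n - 1, by omega⟩
  have hle : ∀ t ∈ Set.Ioo (0 : ℝ) 1, ENNReal.ofReal ((1 - t) ^ (m + 1) * t ^ (m + 1 - 1)) ≤
      ENNReal.ofReal ((1 / 4) ^ m * (1 - t)) := by
    rintro t ⟨h0, h1⟩
    refine ENNReal.ofReal_le_ofReal ?_
    rw [Nat.add_sub_cancel, show (1 - t) ^ (m + 1) * t ^ m = ((1 - t) * t) ^ m * (1 - t) by
      rw [mul_pow]; ring]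
    refine mul_le_mul_of_nonneg_right (pow_le_pow_left₀ ?_ ?_ m) (by linarith)
    · exact mul_nonneg (by linarith) h0.le
    · nlinarith [sq_nonneg (t - 1 / 2)]
  refine (setLIntegral_mono (by fun_prop) hle).trans_eq ?_
  rw [restrict_Ioo_eq_restrict_Ioc, ← ofReal_integral_eq_lintegral_ofReal]
  · rw [← intervalIntegral.integral_of_le zero_le_one]
    congr 1
    rw [intervalIntegral.integral_const_mul, intervalIntegral.integral_sub (by simp) (by simp)]
    simp only [intervalIntegral.integral_const, integral_id]
    rw [div_pow, one_pow]
    field_simp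
    norm_num
    ring
  · exact (Continuous.integrableOn_Icc (by fun_prop)).mono_set Set.Ioc_subset_Icc_self
  · refine (ae_restrict_iff' measurableSet_Ioc).2 (.of_forall fun t ht => ?_)
    exact mul_nonneg (by positivity) (by linarith [ht.2])

/-- A weak form of the identity `μ (T - T) = (2n choose n) μ T` for an `n`-simplex `T`. -/
lemma measure_convexHull_le_measure_diffGauge [Nontrivial E]
    (hT : μ (convexHull ℝ (Set.range b)) ≠ 0) :
    μ (convexHull ℝ (Set.range b)) ≤
      ENNReal.ofReal (2 * finrank ℝ E / 4 ^ finrank ℝ E) * μ {u | diffGauge b u < 1} := by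
  set T := convexHull ℝ (Set.range b) with hTdef
  set n := finrank ℝ E with hn
  have hn0 : 0 < n := finrank_pos
  have hTtop : μ T ≠ ⊤ := (isCompact_convexHull_range b).measure_ne_top
  have hcont := continuous_diffGauge b
  have h1 : μ T * μ T ≤
      (∫⁻ u, ENNReal.ofReal (max 0 (1 - diffGauge b u) ^ n) ∂μ) * μ T := by
    rw [← lintegral_measure_inter_vadd μ (isCompact_convexHull_range b).measurableSet,
      ← lintegral_mul_const _ (by fun_prop)]
    exact lintegral_mono fun u => measure_inter_vadd_convexHull_le b μ u
  refine ((ENNReal.mul_le_mul_iff_left hT hTtop).1 h1).trans ?_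
  have h2 := lintegral_rpow_eq_lintegral_meas_lt_mul μ (f := fun u => max 0 (1 - diffGauge b u))
    (.of_forall fun u => le_max_left _ _) (by fun_prop) (p := n) (by exact_mod_cast hn0)
  simp only [Real.rpow_natCast] at h2
  rw [h2]
  -- The superlevel sets in the layer-cake formula are dilates of the difference body.
  have h3 : ∫⁻ t in Set.Ioi (0 : ℝ), μ {u | t < max 0 (1 - diffGauge b u)} *
        ENNReal.ofReal (t ^ ((n : ℝ) - 1)) ≤
      ∫⁻ t in Set.Ioo (0 : ℝ) 1,
        μ {u | diffGauge b u < 1} * ENNReal.ofReal ((1 - t) ^ n * t ^ (n - 1)) := by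
    rw [← lintegral_indicator measurableSet_Ioi, ← lintegral_indicator measurableSet_Ioo]
    refine lintegral_mono fun t => ?_
    by_cases ht : t ∈ Set.Ioi (0 : ℝ)
    swap
    · rw [Set.indicator_of_notMem ht]; exact zero_le
    rw [Set.indicator_of_mem ht]
    have ht0 : 0 < t := ht
    have hset : {u | t < max 0 (1 - diffGauge b u)} = {u | diffGauge b u < 1 - t} := by
      ext u
      simp only [Set.mem_ofPred_eq, lt_max_iff, not_lt.2 ht0.le, false_or]
      exact lt_sub_comm
    rw [hset]
    rcases lt_or_ge t 1 with h | h
    · rw [Set.indicator_of_mem (Set.mem_Ioo.2 ⟨ht0, h⟩),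
        measure_setOf_diffGauge_lt b μ (sub_pos.2 h), ← Nat.cast_pred hn0, Real.rpow_natCast,
        ENNReal.ofReal_mul (pow_nonneg (by linarith) _)]
      exact le_of_eq (by ring)
    · have : {u | diffGauge b u < 1 - t} = ∅ := Set.eq_empty_of_forall_notMem fun u hu => by
        have := diffGauge_nonneg b u
        have hu' : diffGauge b u < 1 - t := hu
        linarith
      rw [this, measure_empty, zero_mul]
      exact zero_le
  refine (mul_le_mul_right h3 _).trans ?_
  rw [lintegral_const_mul _ (by fun_prop)]
  refine (mul_le_mul_right (mul_le_mul_right (integral_one_sub_pow_mul_pow_le hn0) _) _).trans ?_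
  rw [mul_left_comm, ← ENNReal.ofReal_mul (by positivity), mul_comm]
  exact le_of_eq (by congr 2; ring)

end Volume

/-! ### Lattice coverings and overlaps -/

section Covering

variable {E : Type*} [NormedAddCommGroup E] {Λ : Submodule ℤ E} {T F : Set E}

/-- Deleting from `T` one of its translates by a lattice vector `u ≠ 0` preserves the covering
property: starting from a translate of `T` that covers a given point, step by `u` until the next
translate no longer covers it. -/
lemma iUnion_vadd_diff_vadd_eq_univ [NormedSpace ℝ E] (hT : Bornology.IsBounded T)
    (hcov : ⋃ v : Λ, (v : E) +ᵥ T = Set.univ) {u : Λ} (hu : u ≠ 0) :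
    ⋃ v : Λ, (v : E) +ᵥ (T \ ((u : E) +ᵥ T)) = Set.univ := by
  refine Set.eq_univ_of_forall fun x => ?_
  obtain ⟨v, hv⟩ := Set.mem_iUnion.1 (hcov.symm ▸ Set.mem_univ x : x ∈ ⋃ v : Λ, (v : E) +ᵥ T)
  rw [Set.mem_vadd_set_iff_neg_vadd_mem, vadd_eq_add] at hv
  have hex : ∃ k : ℕ, -(v : E) + x - k • (u : E) ∉ T := by
    by_contra! h
    obtain ⟨R, hR⟩ := hT.exists_norm_le
    have hu' : 0 < ‖(u : E)‖ := norm_pos_iff.2 fun h0 => hu (Subtype.ext h0)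
    obtain ⟨k, hk⟩ := exists_nat_gt ((R + ‖-(v : E) + x‖) / ‖(u : E)‖)
    rw [div_lt_iff₀ hu'] at hk
    have h1 := hR _ (h k)
    have h2 : ‖k • (u : E)‖ = k * ‖(u : E)‖ := by
      rw [← Nat.cast_smul_eq_nsmul ℝ, norm_smul, Real.norm_natCast]
    have h3 := norm_sub_norm_le (k • (u : E)) (-(v : E) + x)
    rw [norm_sub_rev] at h3
    linarith
  classical
  obtain ⟨m, hm⟩ : ∃ m, Nat.find hex = m + 1 := Nat.exists_eq_succ_of_ne_zero fun h0 => by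
    have := Nat.find_spec hex
    rw [h0, zero_smul, sub_zero] at this
    exact this hv
  have hin : -(v : E) + x - m • (u : E) ∈ T := not_not.1 (Nat.find_min hex (by omega))
  have hout : -(v : E) + x - (m + 1) • (u : E) ∉ T := hm ▸ Nat.find_spec hex
  refine Set.mem_iUnion.2 ⟨v + m • u, ?_⟩
  have hx : -((v + m • u : Λ) : E) + x = -(v : E) + x - m • (u : E) := by
    push_cast
    abel
  rw [Set.mem_vadd_set_iff_neg_vadd_mem, vadd_eq_add, hx]
  refine ⟨hin, fun h => hout ?_⟩
  rw [Set.mem_vadd_set_iff_neg_vadd_mem, vadd_eq_add] at h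
  convert h using 1
  rw [succ_nsmul]
  abel

variable [MeasurableSpace E] [BorelSpace E] {μ : Measure E} [μ.IsAddLeftInvariant]

instance vaddInvariantMeasure_submodule : VAddInvariantMeasure Λ E μ :=
  inferInstanceAs (VAddInvariantMeasure Λ.toAddSubgroup E μ)

variable [Countable Λ]

lemma measure_le_of_iUnion_vadd_eq_univ (hF : IsAddFundamentalDomain Λ F μ)
    (hcov : ⋃ v : Λ, (v : E) +ᵥ T = Set.univ) : μ F ≤ μ T := by
  rw [hF.measure_eq_tsum T]
  refine le_trans (measure_mono fun x hx => ?_) (measure_iUnion_le _)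
  obtain ⟨v, hv⟩ := Set.mem_iUnion.1 (hcov.symm ▸ Set.mem_univ x : x ∈ ⋃ v : Λ, (v : E) +ᵥ T)
  exact Set.mem_iUnion.2 ⟨v, hv, hx⟩

/-- In a lattice covering, the overlap of two translates is bounded by the excess volume. -/
lemma measure_inter_vadd_add_measure_le [NormedSpace ℝ E] (hF : IsAddFundamentalDomain Λ F μ)
    (hT : Bornology.IsBounded T) (hTm : MeasurableSet T)
    (hcov : ⋃ v : Λ, (v : E) +ᵥ T = Set.univ) {u : Λ} (hu : u ≠ 0) :
    μ (T ∩ ((u : E) +ᵥ T)) + μ F ≤ μ T := by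
  rw [← measure_inter_add_sdiff T (hTm.const_vadd (u : E))]
  refine add_le_add_right ?_ _
  exact measure_le_of_iUnion_vadd_eq_univ hF (iUnion_vadd_diff_vadd_eq_univ hT hcov hu)

end Covering

/-! ### Lattice coverings by simplices -/

/-- The parameter `r` is chosen so that the bound on the overlaps makes all nonzero lattice points
have gauge at least `r`, while Minkowski's theorem yields one of gauge less than `r`. -/
lemma exists_radius {n : ℕ} (hn : 3 ≤ n) :
    ∃ r : ℝ, 0 < r ∧ r < 1 ∧ 1 / 2 ^ (3 * n + 7) ≤ (1 - r) ^ n ∧ 2 * n < (2 * r) ^ n := by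
  obtain rfl | hn4 := hn.eq_or_lt
  · exact ⟨31 / 32, by norm_num, by norm_num, by norm_num, by norm_num⟩
  · refine ⟨7 / 8, by norm_num, by norm_num, ?_, ?_⟩
    · rw [show (1 - 7 / 8 : ℝ) = 1 / 2 ^ 3 by norm_num, div_pow, one_pow, ← pow_mul]
      exact one_div_le_one_div_of_le (by positivity)
        (pow_le_pow_right₀ one_le_two (Nat.le_add_right _ _))
    · induction n, hn4 using Nat.le_induction with
      | base => norm_num
      | succ m hm ih =>
        have hm' : (4 : ℝ) ≤ m := by exact_mod_cast hm
        have := ih (by omega)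
        rw [pow_succ]
        push_cast
        linarith

section Simplex

variable {ι E : Type*} [Fintype ι] [NormedAddCommGroup E] [NormedSpace ℝ E]
  [FiniteDimensional ℝ E] [MeasurableSpace E] [BorelSpace E] (b : AffineBasis ι ℝ E)
  {μ : Measure E} [μ.IsAddHaarMeasure] {Λ : Submodule ℤ E} [Countable Λ] {F : Set E}

/-- A lattice covering by a simplex exceeds the volume of a fundamental domain by a definite
factor. -/
theorem mul_measure_le_measure_convexHull (hn : 3 ≤ finrank ℝ E)
    (hF : IsAddFundamentalDomain Λ F μ)
    (hcov : ⋃ v : Λ, (v : E) +ᵥ convexHull ℝ (Set.range b) = Set.univ) :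
    (1 + 1 / 2 ^ (3 * finrank ℝ E + 7)) * μ F ≤ μ (convexHull ℝ (Set.range b)) := by
  have : Nontrivial E := nontrivial_of_finrank_pos (R := ℝ) (by omega)
  set T := convexHull ℝ (Set.range b) with hTdef
  set n := finrank ℝ E with hn'
  have hTc : IsCompact T := isCompact_convexHull_range b
  have hFT : μ F ≤ μ T := measure_le_of_iUnion_vadd_eq_univ hF hcov
  have hTtop : μ T ≠ ⊤ := hTc.measure_ne_top
  have hFtop : μ F ≠ ⊤ := ne_top_of_le_ne_top hTtop hFT
  have hT0 : μ T ≠ 0 := fun h => hF.measure_ne_zero (NeZero.ne μ) (le_zero_iff.1 (h ▸ hFT))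
  obtain ⟨r, hr0, hr1, hr, hrn⟩ := exists_radius hn
  -- Minkowski's theorem applies to the dilate `{u | diffGauge b u < r}` of the difference body.
  have hmink : μ F * 2 ^ n < μ {u | diffGauge b u < r} := by
    rw [measure_setOf_diffGauge_lt b μ hr0]
    rcases eq_or_ne (μ {u | diffGauge b u < 1}) ⊤ with htop | htop
    · rw [htop, ENNReal.mul_top (ENNReal.ofReal_pos.2 (by positivity)).ne']
      finiteness
    have hV := measure_convexHull_le_measure_diffGauge b μ hT0
    have hV0 : μ {u | diffGauge b u < 1} ≠ 0 := fun h => by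
      rw [h, mul_zero] at hV
      exact hT0 (le_zero_iff.1 hV)
    have hlt : 2 * (n : ℝ) / 4 ^ n * 2 ^ n < r ^ n := by
      rw [mul_pow] at hrn
      rw [show (4 : ℝ) ^ n = 2 ^ n * 2 ^ n by rw [← mul_pow]; norm_num]
      have : (0 : ℝ) < 2 ^ n := by positivity
      field_simp
      linarith
    calc μ F * 2 ^ n ≤ μ T * 2 ^ n := by gcongr
      _ ≤ ENNReal.ofReal (2 * n / 4 ^ n) * μ {u | diffGauge b u < 1} * 2 ^ n := by gcongr
      _ = ENNReal.ofReal (2 * n / 4 ^ n * 2 ^ n) * μ {u | diffGauge b u < 1} := by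
        rw [ENNReal.ofReal_mul (by positivity), ENNReal.ofReal_pow zero_le_two,
          ENNReal.ofReal_ofNat, mul_right_comm]
      _ < ENNReal.ofReal (r ^ n) * μ {u | diffGauge b u < 1} :=
        ENNReal.mul_lt_mul_left hV0 htop
          ((ENNReal.ofReal_lt_ofReal_iff (by positivity)).2 hlt)
  have hFs : IsAddFundamentalDomain Λ.toAddSubgroup F μ := hF
  have : Countable Λ.toAddSubgroup := ‹Countable Λ›
  obtain ⟨u, hu0, hu⟩ := exists_ne_zero_mem_lattice_of_measure_mul_two_pow_lt_measure hFs
    (fun x hx => (diffGauge_neg b x).trans_lt hx) (convex_diffGauge_lt b r) hmink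
  have hu' : diffGauge b (u : E) < r := hu
  have hover := measure_inter_vadd_add_measure_le hF hTc.isBounded hTc.measurableSet hcov
    (u := ⟨u, u.2⟩) (fun h => hu0 (Subtype.ext (congrArg Subtype.val h)))
  have hov : 1 / 2 ^ (3 * n + 7) * μ F ≤ μ (T ∩ ((u : E) +ᵥ T)) := by
    rw [measure_inter_vadd_convexHull b μ (hu'.trans hr1)]
    refine mul_le_mul' ?_ hFT
    have h2 : (1 / 2 ^ (3 * n + 7) : ℝ≥0∞) = ENNReal.ofReal (1 / 2 ^ (3 * n + 7)) := by
      rw [ENNReal.ofReal_div_of_pos (by positivity), ENNReal.ofReal_one,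
        ENNReal.ofReal_pow zero_le_two, ENNReal.ofReal_ofNat]
    rw [h2]
    exact ENNReal.ofReal_le_ofReal
      (hr.trans (pow_le_pow_left₀ (by linarith) (by linarith) n))
  rw [add_mul, one_mul, add_comm]
  exact (add_le_add_left hov _).trans hover

end Simplex

/-! ### Densities of lattice arrangements -/

section Density

open LatticeCovering

variable {n : ℕ} {Λ : Submodule ℤ (Space n)} {T F : Set (Space n)}

lemma mem_smul_unitCube_iff {ℓ : ℝ} (hℓ : 0 < ℓ) (x : Space n) :
    x ∈ ℓ • unitCube n ↔ ∀ i, |x i| ≤ ℓ / 2 := by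
  rw [Set.mem_smul_set_iff_inv_smul_mem₀ hℓ.ne']
  refine forall_congr' fun i => ?_
  rw [PiLp.smul_apply, smul_eq_mul, abs_mul, abs_of_pos (inv_pos.2 hℓ), inv_mul_le_iff₀ hℓ,
    mul_one_div]

lemma volume_unitCube_ne_zero : volume (unitCube n) ≠ 0 := by
  refine (Measure.measure_pos_of_mem_nhds volume
    (Filter.mem_of_superset (Metric.ball_mem_nhds 0 one_half_pos) ?_)).ne'
  intro x hx i
  exact (PiLp.norm_apply_le x i).trans (mem_ball_zero_iff.1 hx).le

lemma volume_unitCube_ne_top : volume (unitCube n) ≠ ⊤ := by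
  refine (IsCompact.of_isClosed_subset
    ((EuclideanSpace.equiv (Fin n) ℝ).toHomeomorph.isCompact_preimage.2
      (isCompact_univ_pi fun _ => isCompact_Icc (a := (-(1 / 2) : ℝ)) (b := 1 / 2)))
    ?_ fun x (hx : x ∈ unitCube n) i _ => abs_le.1 (hx i)).measure_ne_top
  simp only [unitCube, Set.ofPred_forall]
  exact isClosed_iInter fun i => isClosed_le (by fun_prop) continuous_const

/-- A translate of a fundamental domain that meets the smaller cube belongs to a translate of `T`
that lies in the larger cube. -/
lemma volume_smul_unitCube_mul_le [Countable Λ] (hF : IsAddFundamentalDomain Λ F volume)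
    {R : ℝ} (hFR : ∀ x ∈ F, ‖x‖ ≤ R) (hTR : ∀ x ∈ T, ‖x‖ ≤ R) {ℓ : ℝ} (hℓ : 0 < ℓ)
    (hℓR : 0 < ℓ - 4 * R) :
    volume ((ℓ - 4 * R) • unitCube n) * volume T ≤
      (∑' v, volume (translates T Λ v ∩ ℓ • unitCube n)) * volume F := by
  rw [hF.measure_eq_tsum', ← ENNReal.tsum_mul_right, ← ENNReal.tsum_mul_right]
  refine ENNReal.tsum_le_tsum fun v => ?_
  rcases Set.eq_empty_or_nonempty ((ℓ - 4 * R) • unitCube n ∩ (v +ᵥ F)) with h | ⟨x, hx, hxF⟩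
  · rw [h, measure_empty, zero_mul]
    exact zero_le
  rw [mem_smul_unitCube_iff hℓR] at hx
  obtain ⟨f, hf, rfl⟩ := hxF
  have hsub : translates T Λ v ⊆ ℓ • unitCube n := by
    rintro _ ⟨t, ht, rfl⟩
    rw [mem_smul_unitCube_iff hℓ]
    intro i
    have h1 : |(v : Space n) i + f i| ≤ (ℓ - 4 * R) / 2 := hx i
    have h2 : |f i| ≤ R := (PiLp.norm_apply_le f i).trans (hFR f hf)
    have h3 : |t i| ≤ R := (PiLp.norm_apply_le t i).trans (hTR t ht)
    change |(v : Space n) i + t i| ≤ ℓ / 2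
    rw [abs_le] at *
    constructor <;> linarith
  rw [Set.inter_eq_left.2 hsub, translates, measure_vadd, mul_comm (volume T)]
  exact mul_le_mul' ((measure_mono Set.inter_subset_right).trans_eq
    (measure_vadd volume (v : Space n) F)) le_rfl

/-- The lower limit defining the density of a lattice arrangement is at least the quotient of the
volumes of the body and of a fundamental domain. -/
lemma div_le_density_translates [Countable Λ] (hF : IsAddFundamentalDomain Λ F volume)
    (hFb : Bornology.IsBounded F) (hTb : Bornology.IsBounded T) :
    volume T / volume F ≤ density (translates T Λ) := by
  obtain ⟨R₁, hR₁⟩ := hFb.exists_norm_le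
  obtain ⟨R₂, hR₂⟩ := hTb.exists_norm_le
  set R := max R₁ R₂
  have hF0 : volume F ≠ 0 := hF.measure_ne_zero (NeZero.ne volume)
  have hFtop : volume F ≠ ⊤ := hFb.measure_lt_top.ne
  have hTtop : volume T ≠ ⊤ := hTb.measure_lt_top.ne
  have hlim : Filter.Tendsto
      (fun ℓ : ℝ => ENNReal.ofReal ((1 - 4 * R / ℓ) ^ n) * (volume T / volume F))
      Filter.atTop (nhds (volume T / volume F)) := by
    have h1 : Filter.Tendsto (fun ℓ : ℝ => (1 - 4 * R / ℓ) ^ n) Filter.atTop (nhds 1) := by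
      simpa using ((Filter.Tendsto.const_div_atTop Filter.tendsto_id (4 * R)).const_sub 1).pow n
    simpa using ENNReal.Tendsto.mul_const (ENNReal.tendsto_ofReal h1)
      (Or.inr (ENNReal.div_ne_top hTtop hF0))
  rw [density, ← hlim.liminf_eq]
  refine Filter.liminf_le_liminf ?_
  filter_upwards [Filter.eventually_gt_atTop 0, Filter.eventually_gt_atTop (4 * R)] with ℓ hℓ hℓR
  have hsub : 0 < ℓ - 4 * R := by linarith
  have hW0 : volume (ℓ • unitCube n) ≠ 0 := by
    rw [Measure.addHaar_smul_of_nonneg _ hℓ.le]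
    exact mul_ne_zero (ENNReal.ofReal_pos.2 (by positivity)).ne' volume_unitCube_ne_zero
  have hWtop : volume (ℓ • unitCube n) ≠ ⊤ := by
    rw [Measure.addHaar_smul_of_nonneg _ hℓ.le]
    exact ENNReal.mul_ne_top ENNReal.ofReal_ne_top volume_unitCube_ne_top
  have hscale : ENNReal.ofReal ((1 - 4 * R / ℓ) ^ n) * volume (ℓ • unitCube n) =
      volume ((ℓ - 4 * R) • unitCube n) := by
    rw [Measure.addHaar_smul_of_nonneg _ hℓ.le, Measure.addHaar_smul_of_nonneg _ hsub.le,
      ← mul_assoc, finrank_euclideanSpace_fin,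
      ← ENNReal.ofReal_mul' (by positivity), ← mul_pow]
    congr 3
    field_simp
  rw [ENNReal.le_div_iff_mul_le (Or.inl hW0) (Or.inl hWtop), mul_right_comm, hscale,
    ← mul_div_assoc]
  refine ENNReal.div_le_of_le_mul ?_
  exact volume_smul_unitCube_mul_le hF (fun x hx => (hR₁ x hx).trans (le_max_left _ _))
    (fun x hx => (hR₂ x hx).trans (le_max_right _ _)) hℓ hsub

end Density

theorem theorem2 (n : ℕ) (hn : 3 ≤ n)
    (T : Affine.Simplex ℝ (LatticeCovering.Space n) n) :
    1 + 1 / (2 : ℝ≥0∞) ^ (3 * n + 7) ≤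
      LatticeCovering.latticeCoveringDensity T.closedInterior := by
  have hdim : finrank ℝ (LatticeCovering.Space n) = n := finrank_euclideanSpace_fin
  let b : AffineBasis (Fin (n + 1)) ℝ (LatticeCovering.Space n) :=
    ⟨T.points, T.independent, by
      rw [T.independent.affineSpan_eq_top_iff_card_eq_finrank_add_one, hdim, Fintype.card_fin]⟩
  have hTb : T.closedInterior = convexHull ℝ (Set.range b) :=
    (Affine.Simplex.convexHull_eq_closedInterior T).symm
  refine le_iInf fun Λ => le_iInf fun hΛ => le_iInf fun hcov => ?_
  obtain ⟨_, _⟩ := hΛ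
  rw [hTb] at hcov ⊢
  have hF := ZLattice.isAddFundamentalDomain (Free.chooseBasis ℤ Λ) volume
  have hF0 := hF.measure_ne_zero (NeZero.ne volume)
  have hFb := ZSpan.fundamentalDomain_isBounded ((Free.chooseBasis ℤ Λ).ofZLatticeBasis ℝ)
  have hmain := mul_measure_le_measure_convexHull b (hdim.symm ▸ hn) hF hcov
  rw [hdim] at hmain
  refine le_trans ?_ (div_le_density_translates hF hFb (isCompact_convexHull_range b).isBounded)
  rwa [ENNReal.le_div_iff_mul_le (Or.inl hF0) (Or.inl hFb.measure_lt_top.ne)]
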